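/- For a sequence $f=(f_i(q))_{i\ge 0}$ of polynomials with real coefficients let $\mathcal L f=(g_i(q))_{i\ge 1}$ with $g_i(q)=f_{i-1}(q)f_{i+1}(q)-f_i(q)^2$, and let $\mathcal L^m$ be its $m$-fold iterate (so the sequence $\mathcal L^m f$ is indexed by $i\ge m$). The sequence $f$ is called $k$-$q$-log-convex if for every $0\le m\le k$ all polynomials of the sequence $\mathcal L^m f$ have only nonnegative coefficients. Each of the following six sequences, indexed by $n\ge 0$, is $3$-$q$-log-convex: (i) the Bell polynomials $B_n(q)=\sum_{k=0}^n S(n,k)q^k$, where $S(n,k)$ are the Stirling numbers of the second kind; (ii) the Eulerian polynomials $E_n(q)=\sum_{k=0}^n A(n,k)q^k$, where for $n\ge1$ the Eulerian number $A(n,k)$ is the number of permutations $a_1a_2\cdots a_n$ of $\{1,\dots,n\}$ having exactly $k-1$ descents (indices $1\le i\le n-1$ with $a_i>a_{i+1}$), and $E_0(q)=1$; (iii) the $q$-Schröder numbers $r_n(q)=\sum_{k=0}^n\binom{n+k}{n-k}\frac{1}{k+1}\binom{2k}{k}q^k$; (iv) the $q$-central Delannoy numbers $D_n(q)=\sum_{k=0}^n\binom{n+k}{n-k}\binom{2k}{k}q^k$;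 (v) the Narayana polynomials of type $A$, $N_n(q)=\sum_{k=1}^n\frac1n\binom nk\binom n{k-1}q^k$ for $n\ge1$, and $N_0(q)=1$; (vi) the Narayana polynomials of type $B$, $W_n(q)=\sum_{k=0}^n\binom nk^2q^k$. -/

import Mathlib

open Polynomial

namespace QLogConvex

/-- A real polynomial is `q`-nonnegative (`f ≥_q 0`) if all its coefficients are nonnegative. -/
def CoeffNonneg (f : ℝ[X]) : Prop :=
  ∀ j : ℕ, 0 ≤ f.coeff j

/-- The operator `𝓛`, which sends `(f_i)_{i ≥ 0}` to `(g_i)_{i ≥ 1}` with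
`g_i = f_{i-1} f_{i+1} - f_i ^ 2`. The image is re-indexed to start at `0`: the entry with index
`i` is `g_{i+1}`, so that `𝓛` can be iterated without any boundary convention. -/
noncomputable def opL (f : ℕ → ℝ[X]) : ℕ → ℝ[X] :=
  fun i => f i * f (i + 2) - f (i + 1) ^ 2

/-- A sequence is `k`-`q`-log-convex if, for every `m ≤ k`, all members of its image under the
`m`-fold iterate of `𝓛` have nonnegative coefficients (`m = 0` included). -/
def IsQLogConvex (k : ℕ) (f : ℕ → ℝ[X]) : Prop :=
  ∀ m ≤ k, ∀ i : ℕ, CoeffNonneg (opL^[m] f i)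

/-- The Bell polynomials `B_n(q) = ∑_{k=0}^n S(n,k) q^k`. -/
noncomputable def bellPoly (n : ℕ) : ℝ[X] :=
  ∑ k ∈ Finset.range (n + 1), C (Nat.stirlingSecond n k : ℝ) * X ^ k

/-- The number of descents of a permutation `π = a_1 a_2 ⋯ a_n` (here `n = m + 1`), that is, of
`i ∈ {1, …, n - 1}` with `a_i > a_{i+1}`. -/
def descents {m : ℕ} (π : Equiv.Perm (Fin (m + 1))) : ℕ :=
  (Finset.univ.filter fun i : Fin m => π i.succ < π i.castSucc).card

/-- The Eulerian number `A(n,k)`: the number of permutations of `n` letters having `k - 1`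
descents (for `n ≥ 1`; in particular `A(n,0) = 0`), with the usual convention that `A(0,0) = 1`
and `A(0,k) = 0` for `k ≥ 1`. -/
def eulerianNumber : ℕ → ℕ → ℕ
  | 0, k => if k = 0 then 1 else 0
  | m + 1, k =>
    (Finset.univ.filter fun π : Equiv.Perm (Fin (m + 1)) => descents π + 1 = k).card

/-- The Eulerian polynomials `E_n(q) = ∑_{k=0}^n A(n,k) q^k`. -/
noncomputable def eulerianPoly (n : ℕ) : ℝ[X] :=
  ∑ k ∈ Finset.range (n + 1), C (eulerianNumber n k : ℝ) * X ^ k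

/-- The `q`-Schröder numbers
`r_n(q) = ∑_{k=0}^n binom(n+k, n-k) * (1/(k+1)) * binom(2k, k) * q^k`. -/
noncomputable def schroderPoly (n : ℕ) : ℝ[X] :=
  ∑ k ∈ Finset.range (n + 1),
    C (((n + k).choose (n - k) : ℝ) * (1 / ((k : ℝ) + 1)) * ((2 * k).choose k : ℝ)) * X ^ k

/-- The `q`-central Delannoy numbers `D_n(q) = ∑_{k=0}^n binom(n+k, n-k) * binom(2k, k) * q^k`. -/
noncomputable def delannoyPoly (n : ℕ) : ℝ[X] :=
  ∑ k ∈ Finset.range (n + 1),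
    C (((n + k).choose (n - k) : ℝ) * ((2 * k).choose k : ℝ)) * X ^ k

/-- The Narayana polynomials (of type `A`)
`N_n(q) = ∑_{k=1}^n (1/n) * binom(n, k) * binom(n, k-1) * q^k` for `n ≥ 1`, and `N_0(q) = 1`. -/
noncomputable def narayanaPolyA (n : ℕ) : ℝ[X] :=
  if n = 0 then 1
  else ∑ k ∈ Finset.Icc 1 n,
    C ((1 / (n : ℝ)) * (n.choose k : ℝ) * (n.choose (k - 1) : ℝ)) * X ^ k

/-- The Narayana polynomials of type `B`, `W_n(q) = ∑_{k=0}^n binom(n, k)^2 * q^k`. -/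
noncomputable def narayanaPolyB (n : ℕ) : ℝ[X] :=
  ∑ k ∈ Finset.range (n + 1), C ((n.choose k : ℝ) ^ 2) * X ^ k

end QLogConvex

/-!
Each of the six sequences is the first column of an array whose rows are obtained from one another
by multiplication with a fixed tridiagonal matrix. If the entries and the contiguous principal
minors of that matrix have nonnegative coefficients, so do all its minors. The entry `f (i + j)` of
the Hankel matrix of the first column `f` is the product of row `i` of the array with the first
column of the `j`-th power of the tridiagonal matrix, so by Cauchy–Binet the Hankel minors of `f`
have nonnegative coefficients as well. By Desnanot–Jacobi the entries of `𝓛 f`, `𝓛² f` and `𝓛³ f`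
are polynomials with nonnegative coefficients in those minors.
-/

namespace QLogConvex

section TotalPositivity

variable {R : Type*} [CommRing R] {P : Subsemiring R}

/-- Total positivity of a matrix, with the elements of the subsemiring `P` in the role of the
nonnegative elements of `R`: every minor belongs to `P`. -/
def IsTotallyPositive {ι κ : Type*} [LinearOrder ι] [LinearOrder κ] (P : Subsemiring R)
    (M : Matrix ι κ R) : Prop :=
  ∀ (r : ℕ) (s : Fin r ↪o ι) (t : Fin r ↪o κ), (M.submatrix s t).det ∈ P

theorem IsTotallyPositive.apply_mem {ι κ : Type*} [LinearOrder ι] [LinearOrder κ]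
    {M : Matrix ι κ R} (hM : IsTotallyPositive P M) (i : ι) (j : κ) : M i j ∈ P := by
  simpa using hM 1 (.ofStrictMono (fun _ => i) (Subsingleton.strictMono _))
    (.ofStrictMono (fun _ => j) (Subsingleton.strictMono _))

/-- The Cauchy–Binet expansion, in the form in which it transports positivity: `⋀ x i` is expanded
in the basis of the exterior power given by `b`, and then paired with `⋀ φ j`. -/
theorem det_dual_apply_mem {M I : Type*} [AddCommGroup M] [Module R M] [LinearOrder I]
    (b : Module.Basis I R M) {r : ℕ} (φ : Fin r → Module.Dual R M) (x : Fin r → M)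
    (hx : ∀ s : Fin r ↪o I, (Matrix.of fun i j => b.coord (s j) (x i)).det ∈ P)
    (hφ : ∀ s : Fin r ↪o I, (Matrix.of fun i j => φ j (b (s i))).det ∈ P) :
    (Matrix.of fun i j => φ j (x i)).det ∈ P := by
  rw [← exteriorPower.pairingDual_ιMulti_ιMulti,
    ← (b.exteriorPower r).linearCombination_repr (exteriorPower.ιMulti R r x),
    Finsupp.linearCombination_apply, map_finsuppSum]
  refine sum_mem fun s _ => ?_
  beta_reduce
  rw [map_smul, smul_eq_mul, exteriorPower.basis_apply, exteriorPower.basis_repr_apply,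
    exteriorPower.ιMultiDual_apply_ιMulti, exteriorPower.ιMulti_family,
    exteriorPower.pairingDual_ιMulti_ιMulti]
  exact mul_mem (hx _) (hφ _)

end TotalPositivity

section LeadingMinor

variable {R : Type*} [CommRing R] {M : Matrix ℕ ℕ R} {r : ℕ}

/-- The leading principal minor of order `r` of an infinite matrix. -/
def leadingMinor (M : Matrix ℕ ℕ R) (r : ℕ) : R :=
  (M.submatrix (Fin.val : Fin r → ℕ) Fin.val).det

@[simp]
theorem leadingMinor_zero (M : Matrix ℕ ℕ R) : leadingMinor M 0 = 1 :=
  Matrix.det_fin_zero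

theorem leadingMinor_one (M : Matrix ℕ ℕ R) : leadingMinor M 1 = M 0 0 := by
  simp [leadingMinor]

theorem leadingMinor_transpose (M : Matrix ℕ ℕ R) (r : ℕ) :
    leadingMinor M.transpose r = leadingMinor M r := by
  rw [leadingMinor, ← Matrix.transpose_submatrix, Matrix.det_transpose, leadingMinor]

theorem leadingMinor_congr {N : Matrix ℕ ℕ R} (h : ∀ i < r, ∀ j < r, M i j = N i j) :
    leadingMinor M r = leadingMinor N r :=
  congrArg Matrix.det (Matrix.ext fun i j => h i i.2 j j.2)

theorem leadingMinor_succ_of_row_eq_zero (h : ∀ j < r, M r j = 0) :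
    leadingMinor M (r + 1) = M r r * leadingMinor M r := by
  rw [leadingMinor, Matrix.det_succ_row _ (Fin.last r), Fin.sum_univ_castSucc,
    Finset.sum_eq_zero fun j _ => by simp [h j j.2], zero_add]
  have hsub : (M.submatrix (Fin.val : Fin (r + 1) → ℕ) Fin.val).submatrix
      (Fin.last r).succAbove (Fin.last r).succAbove =
      M.submatrix (Fin.val : Fin r → ℕ) Fin.val := by
    ext i j
    simp [Fin.succAbove_last]
  rw [hsub, ← leadingMinor]
  simp

theorem leadingMinor_succ_of_col_eq_zero (h : ∀ i < r, M i r = 0) :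
    leadingMinor M (r + 1) = M r r * leadingMinor M r := by
  rw [← leadingMinor_transpose, leadingMinor_succ_of_row_eq_zero (M := M.transpose) h,
    leadingMinor_transpose, Matrix.transpose_apply]

theorem leadingMinor_add_two (hrow : ∀ j < r, M (r + 1) j = 0) (hcol : ∀ i < r, M i (r + 1) = 0) :
    leadingMinor M (r + 2) =
      M (r + 1) (r + 1) * leadingMinor M (r + 1) -
        M r (r + 1) * M (r + 1) r * leadingMinor M r := by
  -- The complementary minor of `M (r + 1) r` is the leading minor of `M'`.
  set M' : Matrix ℕ ℕ R := M.submatrix id fun j => if j = r then r + 1 else j with hM'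
  have hminor : leadingMinor M' (r + 1) = M r (r + 1) * leadingMinor M r := by
    rw [leadingMinor_succ_of_col_eq_zero fun i hi => by simpa [hM'] using hcol i hi,
      leadingMinor_congr (N := M) fun i _ j hj => by simp [hM', hj.ne]]
    simp [hM']
  have hsub : (M.submatrix (Fin.val : Fin (r + 2) → ℕ) Fin.val).submatrix
      (Fin.last (r + 1)).succAbove (Fin.last r).castSucc.succAbove =
      M'.submatrix (Fin.val : Fin (r + 1) → ℕ) Fin.val := by
    ext i j
    induction j using Fin.lastCases with
    | last => simp [Fin.succAbove_last, hM']
    | cast j =>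
      simp [Fin.succAbove_last, hM', j.2.ne,
        Fin.succAbove_of_castSucc_lt (Fin.last r).castSucc j.castSucc (by simp [Fin.lt_def])]
  have hlast : (M.submatrix (Fin.val : Fin (r + 2) → ℕ) Fin.val).submatrix
      (Fin.last (r + 1)).succAbove (Fin.last (r + 1)).succAbove =
      M.submatrix (Fin.val : Fin (r + 1) → ℕ) Fin.val := by
    ext i j
    simp [Fin.succAbove_last]
  have hsign : (-1 : R) ^ (r + 1 + r) = -1 := Odd.neg_one_pow ⟨r, by ring⟩
  rw [leadingMinor, Matrix.det_succ_row _ (Fin.last (r + 1)), Fin.sum_univ_castSucc,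
    Fin.sum_univ_castSucc, Finset.sum_eq_zero fun j _ => by simp [hrow j j.2], zero_add, hsub,
    hlast, ← leadingMinor, ← leadingMinor, hminor]
  simp only [Nat.succ_eq_add_one, Fin.val_last, Fin.val_castSucc, hsign, Matrix.submatrix_apply,
    neg_mul, one_mul, Even.add_self, Even.neg_pow, one_pow]
  ring

end LeadingMinor

section Tridiagonal

variable {R : Type*} [CommRing R] {P : Subsemiring R} {M : Matrix ℕ ℕ R}

/-- Infinite tridiagonal matrices. -/
def IsTridiagonal (M : Matrix ℕ ℕ R) : Prop :=
  ∀ i j, i + 1 < j ∨ j + 1 < i → M i j = 0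

/-- The minor of `M` on the consecutive rows and columns `p, p + 1, …, p + m - 1`. -/
def contiguousMinor (M : Matrix ℕ ℕ R) (p m : ℕ) : R :=
  leadingMinor (M.submatrix (p + ·) (p + ·)) m

theorem IsTridiagonal.contiguousMinor_add_two (hM : IsTridiagonal M) (p m : ℕ) :
    contiguousMinor M p (m + 2) =
      M (p + m + 1) (p + m + 1) * contiguousMinor M p (m + 1) -
        M (p + m) (p + m + 1) * M (p + m + 1) (p + m) * contiguousMinor M p m :=
  leadingMinor_add_two (fun j hj => hM _ _ (Or.inr (by dsimp only; omega)))
    fun i hi => hM _ _ (Or.inl (by dsimp only; omega))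

section

variable {t v : ℕ → ℕ} {r : ℕ}

theorem IsTridiagonal.leadingMinor_submatrix_succ (hM : IsTridiagonal M)
    (h : (∀ j < r, t j + 1 < v r) ∨ ∀ j < r, v j + 1 < t r) :
    leadingMinor (M.submatrix t v) (r + 1) =
      M (t r) (v r) * leadingMinor (M.submatrix t v) r := by
  rcases h with h | h
  · exact leadingMinor_succ_of_col_eq_zero fun i hi => hM _ _ (Or.inl (h i hi))
  · exact leadingMinor_succ_of_row_eq_zero fun j hj => hM _ _ (Or.inr (h j hj))

/-- Reading a minor with increasing rows `t` and columns `v` from its last index on the diagonal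
backwards, the maximal run of consecutive diagonal indices splits off as a contiguous minor. -/
theorem IsTridiagonal.exists_leadingMinor_eq_mul_contiguousMinor (hM : IsTridiagonal M)
    (ht : StrictMono t) (hv : StrictMono v) (hr : t r = v r) :
    ∃ q ≤ r, ∃ p m, t r = p + m ∧
      leadingMinor (M.submatrix t v) r =
        leadingMinor (M.submatrix t v) q * contiguousMinor M p m ∧
      leadingMinor (M.submatrix t v) (r + 1) =
        leadingMinor (M.submatrix t v) q * contiguousMinor M p (m + 1) := by
  induction r with
  | zero => exact ⟨0, le_rfl, t 0, 0, by simp [contiguousMinor, leadingMinor_one, hr]⟩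
  | succ r ih =>
    have hlt : t r < t (r + 1) := ht r.lt_succ_self
    have hlv : v r < v (r + 1) := hv r.lt_succ_self
    by_cases hc : t (r + 1) = t r + 1 ∧ v (r + 1) = v r + 1
    · obtain ⟨q, hq, p, m, hp, h₁, h₂⟩ := ih (by omega)
      refine ⟨q, by omega, p, m + 1, by omega, h₂, ?_⟩
      have h₃ : leadingMinor (M.submatrix t v) (r + 2) = _ := leadingMinor_add_two
        (fun j hj => hM _ _ (Or.inr (by have := hv hj; omega)))
        (fun i hi => hM _ _ (Or.inl (by have := ht hi; omega)))
      simp only [Matrix.submatrix_apply] at h₃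
      rw [h₃, h₁, h₂, hM.contiguousMinor_add_two, ← hr, hc.1, hp, show v r = p + m by omega]
      ring
    · refine ⟨r + 1, le_rfl, t (r + 1), 0, rfl, by simp [contiguousMinor], ?_⟩
      rw [hM.leadingMinor_submatrix_succ, ← hr]
      · simp [contiguousMinor, leadingMinor_one, mul_comm]
      · by_cases hgap : t r + 1 < t (r + 1)
        · refine Or.inl fun j hj => ?_
          have := ht.monotone (Nat.lt_succ_iff.1 hj)
          omega
        · refine Or.inr fun j hj => ?_
          have := hv.monotone (Nat.lt_succ_iff.1 hj)
          omega

theorem IsTridiagonal.leadingMinor_submatrix_mem (hM : IsTridiagonal M)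
    (hentry : ∀ i j, M i j ∈ P) (hminor : ∀ p m, contiguousMinor M p m ∈ P)
    (ht : StrictMono t) (hv : StrictMono v) (r : ℕ) :
    leadingMinor (M.submatrix t v) r ∈ P := by
  induction r using Nat.strong_induction_on with
  | _ r ih =>
    rcases r with _ | r
    · simp
    by_cases hr : t r = v r
    · obtain ⟨q, hq, p, m, -, -, h⟩ := hM.exists_leadingMinor_eq_mul_contiguousMinor ht hv hr
      exact h ▸ mul_mem (ih q (by omega)) (hminor _ _)
    · rw [hM.leadingMinor_submatrix_succ]
      · exact mul_mem (hentry _ _) (ih r r.lt_succ_self)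
      · rcases lt_or_gt_of_ne hr with h | h
        · exact Or.inl fun j hj => by have := ht hj; omega
        · exact Or.inr fun j hj => by have := hv hj; omega

end

theorem exists_strictMono_extension {r : ℕ} (t : Fin r ↪o ℕ) :
    ∃ t' : ℕ → ℕ, StrictMono t' ∧ ∀ i : Fin r, t' i = t i := by
  refine ⟨fun i => if h : i < r then t ⟨i, h⟩ else Finset.univ.sup t + i, fun i j hij => ?_,
    fun i => by simp⟩
  dsimp only
  split_ifs with hi hj hj
  · exact t.strictMono (by simpa using hij)
  · have := Finset.le_sup (f := t) (Finset.mem_univ ⟨i, hi⟩)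
    omega
  · omega
  · omega

theorem val_le_orderEmbedding_apply {r : ℕ} (t : Fin r ↪o ℕ) (i : Fin r) : (i : ℕ) ≤ t i := by
  obtain ⟨t', ht', htt'⟩ := exists_strictMono_extension t
  exact htt' i ▸ ht'.le_apply

theorem IsTridiagonal.isTotallyPositive (hM : IsTridiagonal M) (hentry : ∀ i j, M i j ∈ P)
    (hminor : ∀ p m, contiguousMinor M p m ∈ P) : IsTotallyPositive P M := by
  intro r s t
  obtain ⟨s', hs', hss'⟩ := exists_strictMono_extension s
  obtain ⟨t', ht', htt'⟩ := exists_strictMono_extension t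
  have h := hM.leadingMinor_submatrix_mem hentry hminor hs' ht' r
  rw [leadingMinor, Matrix.submatrix_submatrix] at h
  convert h using 3
  · exact funext fun i => (hss' i).symm
  · exact funext fun i => (htt' i).symm

end Tridiagonal

section Hankel

variable {R : Type*} [CommRing R] {P : Subsemiring R} {T : Module.End R (ℕ →₀ R)}

/-- The minor of order `r` of the Hankel matrix `(f (i + j))` on the rows from `i` on and on the
first columns. -/
def hankelDet (f : ℕ → R) (r i : ℕ) : R :=
  (Matrix.of fun a b : Fin r => f (i + a + b)).det

/-- The matrix of an endomorphism of `ℕ →₀ R` acting on row vectors: row `k` is the image of the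
`k`-th basis vector. -/
noncomputable def rowMatrix (T : Module.End R (ℕ →₀ R)) : Matrix ℕ ℕ R :=
  Matrix.of fun k l => T (Finsupp.single k 1) l

theorem apply_eq_sum_mul_rowMatrix (T : Module.End R (ℕ →₀ R)) (v : ℕ →₀ R) (l : ℕ) :
    T v l = v.sum fun k c => c * rowMatrix T k l := by
  conv_lhs => rw [← Finsupp.sum_single v, map_finsuppSum, Finsupp.sum_apply]
  refine Finsupp.sum_congr fun k _ => ?_
  rw [← mul_one (v k), ← smul_eq_mul, ← Finsupp.smul_single, map_smul]
  simp [rowMatrix]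

theorem rowMatrix_pow_mem (hT : ∀ k l, rowMatrix T k l ∈ P) (n k l : ℕ) :
    rowMatrix (T ^ n) k l ∈ P := by
  induction n generalizing l with
  | zero =>
    rw [rowMatrix, Matrix.of_apply, pow_zero, Module.End.one_apply, Finsupp.single_apply]
    split_ifs
    exacts [one_mem P, zero_mem P]
  | succ n ih =>
    rw [rowMatrix, Matrix.of_apply, pow_succ', Module.End.mul_apply, apply_eq_sum_mul_rowMatrix]
    exact sum_mem fun j _ => mul_mem (ih j) (hT j l)

theorem rowMatrix_pow_eq_zero (hT : IsTridiagonal (rowMatrix T)) {n k l : ℕ}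
    (h : k + n < l ∨ l + n < k) : rowMatrix (T ^ n) k l = 0 := by
  induction n generalizing l with
  | zero => simp [rowMatrix, Finsupp.single_apply, show k ≠ l by omega]
  | succ n ih =>
    rw [rowMatrix, Matrix.of_apply, pow_succ', Module.End.mul_apply, apply_eq_sum_mul_rowMatrix]
    refine Finset.sum_eq_zero fun j _ => ?_
    by_cases hj : k + n < j ∨ j + n < k
    · exact mul_eq_zero_of_left (ih hj) _
    · exact mul_eq_zero_of_right _ (hT j l (by omega))

theorem det_rowMatrix_pow_mem (hT : IsTridiagonal (rowMatrix T))
    (hP : IsTotallyPositive P (rowMatrix T)) {r : ℕ} (i : ℕ) (t : Fin r ↪o ℕ) :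
    (Matrix.of fun a b : Fin r => rowMatrix (T ^ (i + a)) 0 (t b)).det ∈ P := by
  induction i generalizing t with
  | zero =>
    simp only [zero_add]
    rw [Matrix.det_of_isLowerTriangular]
    · exact prod_mem fun a _ => rowMatrix_pow_mem hP.apply_mem _ _ _
    · intro a b hab
      have hab : (a : ℕ) < b := hab
      exact rowMatrix_pow_eq_zero hT
        (Or.inl (by have := val_le_orderEmbedding_apply t b; omega))
  | succ i ih =>
    have h := det_dual_apply_mem (P := P) Finsupp.basisSingleOne
      (fun b : Fin r => Finsupp.lapply (t b) ∘ₗ T)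
      (fun a : Fin r => (T ^ (i + a)) (Finsupp.single 0 1))
      (fun s => by simpa [rowMatrix] using ih s) (fun s => hP r s t)
    simpa [rowMatrix, add_right_comm i 1, pow_succ'] using h

theorem hankelDet_rowMatrix_pow_mem (hT : IsTridiagonal (rowMatrix T))
    (hP : IsTotallyPositive P (rowMatrix T)) (r i : ℕ) :
    hankelDet (fun n => rowMatrix (T ^ n) 0 0) r i ∈ P := by
  have h := det_dual_apply_mem (P := P) Finsupp.basisSingleOne
    (fun b : Fin r => Finsupp.lapply 0 ∘ₗ T ^ (b : ℕ))
    (fun a : Fin r => (T ^ (i + a)) (Finsupp.single 0 1))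
    (fun s => by simpa [rowMatrix] using det_rowMatrix_pow_mem hT hP i s) (fun s => ?_)
  · simpa [hankelDet, rowMatrix, add_comm _ (_ : ℕ), pow_add] using h
  · change (Matrix.of fun a b : Fin r => rowMatrix (T ^ (b : ℕ)) (s a) 0).det ∈ P
    rw [Matrix.det_of_isUpperTriangular]
    · exact prod_mem fun a _ => rowMatrix_pow_mem hP.apply_mem _ _ _
    · intro a b hab
      have hab : (b : ℕ) < a := hab
      exact rowMatrix_pow_eq_zero hT
        (Or.inr (by have := val_le_orderEmbedding_apply s a; omega))

end Hankel

section Condensation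

variable {R : Type*} [CommRing R] (f : ℕ → R) (i : ℕ)

theorem hankelDet_one : hankelDet f 1 i = f i := by
  simp [hankelDet]

theorem hankelDet_two : hankelDet f 2 i = f i * f (i + 2) - f (i + 1) ^ 2 := by
  simp [hankelDet, Matrix.det_fin_two, add_assoc, sq]

theorem hankelDet_three : hankelDet f 3 i =
    f i * hankelDet f 2 (i + 2) - f (i + 1) * (f (i + 1) * f (i + 4) - f (i + 2) * f (i + 3)) +
      f (i + 2) * hankelDet f 2 (i + 1) := by
  simp only [hankelDet, Matrix.det_fin_three, Matrix.det_fin_two, Matrix.of_apply, Fin.val_zero,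
    Fin.val_one, Fin.val_two, add_zero, add_assoc, Nat.reduceAdd]
  ring

theorem hankelDet_four : hankelDet f 4 i =
    f i * hankelDet f 3 (i + 2)
      - f (i + 1) * (f (i + 1) * hankelDet f 2 (i + 4)
          - f (i + 3) * (f (i + 2) * f (i + 6) - f (i + 3) * f (i + 5))
          + f (i + 4) * (f (i + 2) * f (i + 5) - f (i + 3) * f (i + 4)))
      + f (i + 2) * (f (i + 1) * (f (i + 3) * f (i + 6) - f (i + 4) * f (i + 5))
          - f (i + 2) * (f (i + 2) * f (i + 6) - f (i + 3) * f (i + 5))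
          + f (i + 4) * hankelDet f 2 (i + 2))
      - f (i + 3) * hankelDet f 3 (i + 1) := by
  have h₂ : Fin.succ (2 : Fin 3) = 3 := rfl
  rw [hankelDet, Matrix.det_succ_row_zero]
  simp only [hankelDet_three, hankelDet_two, Fin.sum_univ_four, Matrix.det_fin_three, add_assoc,
    Matrix.of_apply, Matrix.submatrix_apply, Fin.succAbove, Fin.isValue, Fin.succ_zero_eq_one,
    Fin.succ_one_eq_two, h₂, Fin.castSucc_zero, Fin.castSucc_one, Fin.reduceCastSucc, Fin.reduceLT,
    Fin.coe_ofNat_eq_mod, Nat.reduceMod, Nat.reduceAdd, zero_add, lt_self_iff_false, ↓reduceIte,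
    Nat.succ_eq_add_one, Fin.lt_one_iff, Fin.reduceEq, not_lt_zero, zero_lt_one, pow_zero, add_zero,
    one_mul, pow_one, even_two, Even.neg_pow, one_pow, Nat.zero_mod, Nat.one_mod]
  ring

/-- The Desnanot–Jacobi identity for Hankel determinants, in the orders `3` and `4` (next). -/
theorem hankelDet_three_mul : f (i + 2) * hankelDet f 3 i =
    hankelDet f 2 i * hankelDet f 2 (i + 2) - hankelDet f 2 (i + 1) ^ 2 := by
  simp only [hankelDet_three, hankelDet_two, add_assoc, Nat.reduceAdd]
  ring

theorem hankelDet_four_mul : hankelDet f 2 (i + 2) * hankelDet f 4 i =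
    hankelDet f 3 i * hankelDet f 3 (i + 2) - hankelDet f 3 (i + 1) ^ 2 := by
  simp only [hankelDet_four, hankelDet_three, hankelDet_two, add_assoc, Nat.reduceAdd]
  ring

end Condensation

/-- The real polynomials with nonnegative coefficients. -/
def nonnegCoeff : Subsemiring ℝ[X] where
  carrier := {f | CoeffNonneg f}
  zero_mem' _ := by simp
  one_mem' j := by rw [coeff_one]; split_ifs <;> norm_num
  add_mem' hf hg j := by rw [coeff_add]; exact add_nonneg (hf j) (hg j)
  mul_mem' hf hg j := by
    rw [coeff_mul]; exact Finset.sum_nonneg fun x _ => mul_nonneg (hf _) (hg _)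

theorem X_mem_nonnegCoeff : (X : ℝ[X]) ∈ nonnegCoeff := fun j => by
  rw [coeff_X]; split_ifs <;> norm_num

section IteratedOpL

variable (f : ℕ → ℝ[X])

theorem opL_eq_hankelDet : opL f = hankelDet f 2 :=
  funext fun i => (hankelDet_two f i).symm

theorem opL_iterate_two (i : ℕ) : opL^[2] f i = f (i + 2) * hankelDet f 3 i := by
  rw [hankelDet_three_mul, ← opL_eq_hankelDet]
  rfl

theorem opL_iterate_three (i : ℕ) :
    opL^[3] f i = hankelDet f 2 (i + 2) *
      (f (i + 2) * f (i + 4) * hankelDet f 4 i + hankelDet f 3 (i + 1) ^ 2) := by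
  rw [Function.iterate_succ_apply', opL]
  simp only [opL_iterate_two, add_assoc, Nat.reduceAdd]
  linear_combination -f (i + 2) * f (i + 4) * hankelDet_four_mul f i
    - hankelDet f 3 (i + 1) ^ 2 * hankelDet_two f (i + 2)

theorem isQLogConvex_three_of_hankelDet_mem {f : ℕ → ℝ[X]}
    (h : ∀ r i, hankelDet f r i ∈ nonnegCoeff) : IsQLogConvex 3 f := by
  have hf i : f i ∈ nonnegCoeff := hankelDet_one f i ▸ h 1 i
  intro m hm i
  change opL^[m] f i ∈ nonnegCoeff
  interval_cases m
  · exact hf i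
  · rw [Function.iterate_one, opL_eq_hankelDet]
    exact h 2 i
  · rw [opL_iterate_two]
    exact mul_mem (hf _) (h 3 i)
  · rw [opL_iterate_three]
    exact mul_mem (h 2 _) (add_mem (mul_mem (mul_mem (hf _) (hf _)) (h 4 i)) (pow_mem (h 3 _) 2))

end IteratedOpL

section CatalanStieltjes

variable {R : Type*} [CommRing R] {P : Subsemiring R} {u g s : ℕ → R} {A : ℕ → ℕ → R}

/-- The infinite tridiagonal matrix with diagonal `g`, superdiagonal `u` and subdiagonal `s`. -/
def tridiagonal (u g s : ℕ → R) : Matrix ℕ ℕ R :=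
  Matrix.of fun i j =>
    if j = i + 1 then u i else if j = i then g i else if i = j + 1 then s j else 0

theorem isTridiagonal_tridiagonal (u g s : ℕ → R) : IsTridiagonal (tridiagonal u g s) :=
  fun i j h => by simp [tridiagonal, show j ≠ i + 1 ∧ j ≠ i ∧ i ≠ j + 1 by omega]

theorem tridiagonal_apply_mem (hu : ∀ k, u k ∈ P) (hg : ∀ k, g k ∈ P) (hs : ∀ k, s k ∈ P)
    (i j : ℕ) : tridiagonal u g s i j ∈ P := by
  rw [tridiagonal, Matrix.of_apply]
  split_ifs
  exacts [hu _, hg _, hs _, zero_mem P]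

theorem contiguousMinor_tridiagonal_zero (p : ℕ) : contiguousMinor (tridiagonal u g s) p 0 = 1 :=
  leadingMinor_zero _

theorem contiguousMinor_tridiagonal_one (p : ℕ) :
    contiguousMinor (tridiagonal u g s) p 1 = g p := by
  rw [contiguousMinor, leadingMinor_one]
  simp [tridiagonal]

theorem contiguousMinor_tridiagonal_add_two (p m : ℕ) :
    contiguousMinor (tridiagonal u g s) p (m + 2) =
      g (p + m + 1) * contiguousMinor (tridiagonal u g s) p (m + 1) -
        u (p + m) * s (p + m) * contiguousMinor (tridiagonal u g s) p m := by
  rw [(isTridiagonal_tridiagonal u g s).contiguousMinor_add_two]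
  simp [tridiagonal, add_assoc]

/-- If `g k = x k + y k` and `u k * s k = x k * y (k + 1)` then the tridiagonal matrix is the
product of two bidiagonal ones, one with diagonal `x`, up to the corner `y p`. -/
theorem contiguousMinor_tridiagonal_mem {x y : ℕ → R} {p : ℕ} (hx : ∀ k, x k ∈ P)
    (hy : ∀ k, y k ∈ P) (hg : ∀ k ≥ p, g k = x k + y k)
    (hus : ∀ k ≥ p, u k * s k = x k * y (k + 1)) (m : ℕ) :
    contiguousMinor (tridiagonal u g s) p m ∈ P := by
  suffices h : contiguousMinor (tridiagonal u g s) p m ∈ P ∧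
      contiguousMinor (tridiagonal u g s) p (m + 1) -
        x (p + m) * contiguousMinor (tridiagonal u g s) p m ∈ P from h.1
  induction m with
  | zero =>
    rw [contiguousMinor_tridiagonal_zero, contiguousMinor_tridiagonal_one, hg _ le_rfl]
    exact ⟨one_mem P, by simpa using hy p⟩
  | succ m ih =>
    refine ⟨by simpa using add_mem ih.2 (mul_mem (hx (p + m)) ih.1), ?_⟩
    convert mul_mem (hy (p + m + 1)) ih.2 using 1
    rw [contiguousMinor_tridiagonal_add_two, hus _ (by omega), hg (p + m + 1) (by omega),
      ← add_assoc p m 1]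
    ring

/-- The endomorphism whose matrix, acting on row vectors, is `tridiagonal u g s`. -/
noncomputable def tridiagonalEnd (u g s : ℕ → R) : Module.End R (ℕ →₀ R) :=
  Finsupp.linearCombination R fun
    | 0 => .single 0 (g 0) + .single 1 (u 0)
    | k + 1 => .single k (s k) + .single (k + 1) (g (k + 1)) + .single (k + 2) (u (k + 1))

theorem rowMatrix_tridiagonalEnd (u g s : ℕ → R) :
    rowMatrix (tridiagonalEnd u g s) = tridiagonal u g s := by
  ext k l
  rcases k with _ | k <;>
    simp only [rowMatrix, tridiagonalEnd, tridiagonal, Matrix.of_apply, Finsupp.single_apply,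
      Finsupp.linearCombination_single, one_smul, Finsupp.add_apply] <;>
    grind

theorem tridiagonalEnd_single (u g s : ℕ → R) (k l : ℕ) :
    tridiagonalEnd u g s (Finsupp.single k 1) l = tridiagonal u g s k l :=
  congrFun₂ (rowMatrix_tridiagonalEnd u g s) k l

theorem tridiagonalEnd_apply_zero (v : ℕ →₀ R) :
    tridiagonalEnd u g s v 0 = g 0 * v 0 + s 0 * v 1 := by
  suffices h : Finsupp.lapply 0 ∘ₗ tridiagonalEnd u g s =
      g 0 • Finsupp.lapply 0 + s 0 • Finsupp.lapply 1 from LinearMap.congr_fun h v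
  ext k
  simp only [LinearMap.comp_apply, LinearMap.add_apply, LinearMap.smul_apply, Finsupp.lsingle_apply,
    Finsupp.lapply_apply, Finsupp.single_apply, tridiagonalEnd_single, tridiagonal, Matrix.of_apply,
    smul_eq_mul]
  grind

theorem tridiagonalEnd_apply_succ (v : ℕ →₀ R) (l : ℕ) :
    tridiagonalEnd u g s v (l + 1) = u l * v l + g (l + 1) * v (l + 1) + s (l + 1) * v (l + 2) := by
  suffices h : Finsupp.lapply (l + 1) ∘ₗ tridiagonalEnd u g s =
      u l • Finsupp.lapply l + g (l + 1) • Finsupp.lapply (l + 1) +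
        s (l + 1) • Finsupp.lapply (l + 2)
      from LinearMap.congr_fun h v
  ext k
  simp only [LinearMap.comp_apply, LinearMap.add_apply, LinearMap.smul_apply, Finsupp.lsingle_apply,
    Finsupp.lapply_apply, Finsupp.single_apply, tridiagonalEnd_single, tridiagonal, Matrix.of_apply,
    smul_eq_mul]
  grind

/-- `A` is the Catalan–Stieltjes array of `u, g, s`: its row `0` is `(1, 0, 0, …)`, and each
further row is the previous one multiplied by `tridiagonal u g s`. -/
structure IsCatalanStieltjes (A : ℕ → ℕ → R) (u g s : ℕ → R) : Prop where
  zero_zero : A 0 0 = 1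
  zero_succ : ∀ k, A 0 (k + 1) = 0
  succ_zero : ∀ n, A (n + 1) 0 = g 0 * A n 0 + s 0 * A n 1
  succ_succ : ∀ n k,
    A (n + 1) (k + 1) = u k * A n k + g (k + 1) * A n (k + 1) + s (k + 1) * A n (k + 2)

theorem IsCatalanStieltjes.rowMatrix_tridiagonalEnd_pow (h : IsCatalanStieltjes A u g s)
    (n k : ℕ) : rowMatrix (tridiagonalEnd u g s ^ n) 0 k = A n k := by
  induction n generalizing k with
  | zero => cases k <;> simp [rowMatrix, h.zero_zero, h.zero_succ]
  | succ n ih =>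
    simp only [rowMatrix, Matrix.of_apply] at ih ⊢
    rw [pow_succ', Module.End.mul_apply]
    cases k with
    | zero => rw [tridiagonalEnd_apply_zero, ih, ih, h.succ_zero]
    | succ k => rw [tridiagonalEnd_apply_succ, ih, ih, ih, h.succ_succ]

theorem IsCatalanStieltjes.hankelDet_mem (h : IsCatalanStieltjes A u g s) (hu : ∀ k, u k ∈ P)
    (hg : ∀ k, g k ∈ P) (hs : ∀ k, s k ∈ P)
    (hminor : ∀ p m, contiguousMinor (tridiagonal u g s) p m ∈ P) (r i : ℕ) :
    hankelDet (fun n => A n 0) r i ∈ P := by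
  have htri := rowMatrix_tridiagonalEnd u g s ▸ isTridiagonal_tridiagonal u g s
  have hTP : IsTotallyPositive P (rowMatrix (tridiagonalEnd u g s)) :=
    rowMatrix_tridiagonalEnd u g s ▸ (isTridiagonal_tridiagonal u g s).isTotallyPositive
      (tridiagonal_apply_mem hu hg hs) hminor
  simpa only [h.rowMatrix_tridiagonalEnd_pow] using hankelDet_rowMatrix_pow_mem htri hTP r i

end CatalanStieltjes

theorem IsCatalanStieltjes.isQLogConvex_three {A : ℕ → ℕ → ℝ[X]} {u g s : ℕ → ℝ[X]}
    (h : IsCatalanStieltjes A u g s) (hu : ∀ k, u k ∈ nonnegCoeff) (hg : ∀ k, g k ∈ nonnegCoeff)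
    (hs : ∀ k, s k ∈ nonnegCoeff)
    (hminor : ∀ p m, contiguousMinor (tridiagonal u g s) p m ∈ nonnegCoeff) :
    IsQLogConvex 3 fun n => A n 0 :=
  isQLogConvex_three_of_hankelDet_mem (h.hankelDet_mem hu hg hs hminor)

theorem IsCatalanStieltjes.isQLogConvex_three_of_eq_add {A : ℕ → ℕ → ℝ[X]} {u g s x y : ℕ → ℝ[X]}
    (h : IsCatalanStieltjes A u g s) (hu : ∀ k, u k ∈ nonnegCoeff) (hs : ∀ k, s k ∈ nonnegCoeff)
    (hx : ∀ k, x k ∈ nonnegCoeff) (hy : ∀ k, y k ∈ nonnegCoeff) (hg : ∀ k, g k = x k + y k)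
    (hus : ∀ k, u k * s k = x k * y (k + 1)) : IsQLogConvex 3 fun n => A n 0 :=
  h.isQLogConvex_three hu (fun k => hg k ▸ add_mem (hx k) (hy k)) hs fun _ =>
    contiguousMinor_tridiagonal_mem hx hy (fun k _ => hg k) (fun k _ => hus k)

section Quadratic

variable {R : Type*} [CommRing R] (a c : R)

/-- The quadratic polynomial with roots `-a` and `-c`. For suitable `a` and `c` the central
coefficients of its powers are the Narayana polynomials of type `B` or the Delannoy polynomials, and
the coefficients next to the central ones are multiples of those of type `A` or of the Schröder
polynomials. -/
noncomputable def quad (a c : R) : R[X] :=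
  (X + C a) * (X + C c)

theorem coeff_mul_quad (p : R[X]) (m : ℕ) :
    (p * quad a c).coeff (m + 2) =
      p.coeff m + (a + c) * p.coeff (m + 1) + a * c * p.coeff (m + 2) := by
  have h : p * quad a c = p * X ^ 2 + C (a + c) * (p * X) + C (a * c) * p := by
    simp only [quad, map_mul, map_add]
    ring
  rw [h, coeff_add, coeff_add, coeff_C_mul, coeff_C_mul, coeff_mul_X_pow, coeff_mul_X]

theorem coeff_quad_pow_mul_sub (n m : ℕ) :
    (n + 1) * (quad a c ^ n * (X ^ 2 - C (a * c))).coeff (m + 1) =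
      (m - n) * (quad a c ^ (n + 1)).coeff (m + 1) := by
  -- `X ^ 2 - a * c = X * (quad a c)' - quad a c`
  have h : C ((n : R) + 1) * (quad a c ^ n * (X ^ 2 - C (a * c))) =
      X * derivative (quad a c ^ (n + 1)) - C ((n : R) + 1) * quad a c ^ (n + 1) := by
    rw [derivative_pow_succ]
    simp only [quad, derivative_mul, derivative_X, derivative_C, map_mul, map_add, C_1]
    ring
  have hcoeff := congrArg (coeff · (m + 1)) h
  simp only [coeff_C_mul, coeff_sub, coeff_X_mul, coeff_derivative] at hcoeff
  linear_combination hcoeff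

/-- The Catalan–Stieltjes array whose first column is the Narayana-type sequence of `a` and `c`:
its continued fraction has the coefficients `a, c, a, c, …`. -/
noncomputable def narayanaArray (a c : R) : ℕ → ℕ → R
  | 0, k => if k = 0 then 1 else 0
  | n + 1, k => ((X + C a) * (quad a c ^ n * (X ^ 2 - C (a * c)))).coeff (k + n + 2)

theorem narayanaArray_succ (n k : ℕ) : narayanaArray a c (n + 1) k =
    ((X + C a) * (quad a c ^ n * (X ^ 2 - C (a * c)))).coeff (k + n + 2) :=
  rfl

theorem narayanaArray_add_two (n k : ℕ) : narayanaArray a c (n + 2) k =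
    ((X + C a) * (quad a c ^ n * (X ^ 2 - C (a * c)))).coeff (k + n + 1) +
      (a + c) * narayanaArray a c (n + 1) k + a * c * narayanaArray a c (n + 1) (k + 1) := by
  have h := coeff_mul_quad a c ((X + C a) * (quad a c ^ n * (X ^ 2 - C (a * c)))) (k + n + 1)
  rw [mul_assoc, mul_right_comm (quad a c ^ n), ← pow_succ] at h
  rw [narayanaArray_succ, narayanaArray_succ, narayanaArray_succ, add_right_comm k 1 n]
  exact h

section CharZero

variable [IsDomain R] [CharZero R]

theorem coeff_quad_pow_mul_sub_center (n : ℕ) :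
    (quad a c ^ n * (X ^ 2 - C (a * c))).coeff (n + 1) = 0 := by
  have h := coeff_quad_pow_mul_sub a c n n
  rw [sub_self, zero_mul] at h
  exact (mul_eq_zero.1 h).resolve_left n.cast_add_one_ne_zero

theorem coeff_quad_pow_symm (n : ℕ) :
    (quad a c ^ (n + 1)).coeff n = a * c * (quad a c ^ (n + 1)).coeff (n + 2) := by
  have h := coeff_quad_pow_mul_sub_center a c (n + 1)
  rw [mul_sub, coeff_sub, coeff_mul_X_pow, coeff_mul_C] at h
  linear_combination h

theorem isCatalanStieltjes_coeff_quad_pow :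
    IsCatalanStieltjes (fun n k => (quad a c ^ n).coeff (n + k)) (fun _ => 1) (fun _ => a + c)
      (fun k => if k = 0 then 2 * (a * c) else a * c) where
  zero_zero := by simp
  zero_succ k := by simp [coeff_one]
  succ_zero n := by
    rcases n with _ | n
    · simp [quad, coeff_one, mul_add]
    · have h := coeff_mul_quad a c (quad a c ^ (n + 1)) n
      rw [coeff_quad_pow_symm] at h
      simp only [add_zero, ↓reduceIte]
      rw [pow_succ _ (n + 1), h]
      ring
  succ_succ n k := by
    rw [if_neg k.succ_ne_zero, show n + 1 + (k + 1) = n + k + 2 by ring, pow_succ,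
      coeff_mul_quad, one_mul]
    rfl

theorem isCatalanStieltjes_narayanaArray :
    IsCatalanStieltjes (narayanaArray a c) (fun _ => 1) (fun k => if k = 0 then a else a + c)
      (fun _ => a * c) where
  zero_zero := by rw [narayanaArray, if_pos rfl]
  zero_succ k := by rw [narayanaArray, if_neg k.succ_ne_zero]
  succ_zero n := by
    rcases n with _ | n
    · simp [narayanaArray, add_mul, coeff_X_mul, coeff_X_pow]
    · have hcenter : ((X + C a) * (quad a c ^ n * (X ^ 2 - C (a * c)))).coeff (n + 1) +
          c * narayanaArray a c (n + 1) 0 = 0 := by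
        rw [← coeff_quad_pow_mul_sub_center a c (n + 1), narayanaArray_succ, zero_add,
          ← coeff_mul_X, ← coeff_C_mul, ← coeff_add]
        congr 1
        rw [pow_succ, quad]
        ring
      rw [narayanaArray_add_two, if_pos rfl, zero_add]
      linear_combination hcenter
  succ_succ n k := by
    rw [if_neg k.succ_ne_zero]
    rcases n with _ | n
    · rcases k with _ | _ | k <;>
        simp [narayanaArray, add_mul, coeff_X_mul, coeff_X_pow]
    · rw [narayanaArray_add_two, one_mul, narayanaArray_succ a c n k, add_right_comm k 1 n]

theorem succ_mul_narayanaArray_succ_zero (n : ℕ) :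
    (n + 1) * (c * narayanaArray a c (n + 1) 0) = (quad a c ^ (n + 1)).coeff n := by
  have h := coeff_quad_pow_mul_sub a c n (n + 1)
  rw [narayanaArray_succ, zero_add, add_mul (X : R[X]), coeff_add, coeff_X_mul, coeff_C_mul,
    coeff_quad_pow_mul_sub_center, coeff_quad_pow_symm]
  push_cast at h
  linear_combination a * c * h

end CharZero

theorem contiguousMinor_eq_pow_add_pow (m : ℕ) :
    contiguousMinor (tridiagonal (fun _ => 1) (fun _ => a + c)
      fun k => if k = 0 then 2 * (a * c) else a * c) 0 (m + 1) = a ^ (m + 1) + c ^ (m + 1) := by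
  induction m using Nat.twoStepInduction with
  | zero => simp [contiguousMinor_tridiagonal_one]
  | one =>
    rw [contiguousMinor_tridiagonal_add_two, contiguousMinor_tridiagonal_one,
      contiguousMinor_tridiagonal_zero, if_pos rfl]
    ring
  | more m ih₁ ih₂ =>
    rw [contiguousMinor_tridiagonal_add_two, ih₁, ih₂, if_neg (by omega)]
    ring

end Quadratic

section QuadraticLogConvex

variable {a c : ℝ[X]}

theorem isQLogConvex_three_coeff_quad_pow (ha : a ∈ nonnegCoeff) (hc : c ∈ nonnegCoeff) :
    IsQLogConvex 3 fun n => (quad a c ^ n).coeff n := by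
  have hac := mul_mem ha hc
  refine (isCatalanStieltjes_coeff_quad_pow a c).isQLogConvex_three (fun _ => one_mem _)
    (fun _ => add_mem ha hc) (fun k => ?_) (fun p m => ?_)
  · split_ifs
    · exact two_mul (a * c) ▸ add_mem hac hac
    · exact hac
  · rcases p with _ | p
    · rcases m with _ | m
      · rw [contiguousMinor_tridiagonal_zero]
        exact one_mem _
      · rw [contiguousMinor_eq_pow_add_pow]
        exact add_mem (pow_mem ha _) (pow_mem hc _)
    · exact contiguousMinor_tridiagonal_mem (x := fun _ => a) (y := fun _ => c) (fun _ => ha)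
        (fun _ => hc) (fun _ _ => rfl) (fun k hk => by rw [if_neg (by omega), one_mul]) m

theorem isQLogConvex_three_of_succ_mul_eq (ha : a ∈ nonnegCoeff) (hc : c ∈ nonnegCoeff)
    (hc₀ : c ≠ 0) {f : ℕ → ℝ[X]} (hf₀ : f 0 = 1)
    (hf : ∀ n : ℕ, (n + 1) * (c * f (n + 1)) = (quad a c ^ (n + 1)).coeff n) :
    IsQLogConvex 3 f := by
  have hfA : f = fun n => narayanaArray a c n 0 := by
    funext n
    rcases n with _ | n
    · rw [hf₀, narayanaArray, if_pos rfl]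
    · have h := (hf n).trans (succ_mul_narayanaArray_succ_zero a c n).symm
      exact mul_left_cancel₀ hc₀ (mul_left_cancel₀ n.cast_add_one_ne_zero h)
  rw [hfA]
  refine (isCatalanStieltjes_narayanaArray a c).isQLogConvex_three_of_eq_add (x := fun _ => a)
    (y := fun k => if k = 0 then 0 else c) (fun _ => one_mem _) (fun _ => mul_mem ha hc)
    (fun _ => ha) (fun k => ?_) (fun k => ?_) (fun k => by simp)
  · split_ifs
    exacts [zero_mem _, hc]
  · split_ifs <;> simp

end QuadraticLogConvex

section NarayanaDelannoySchroder

theorem coeff_quad_X_one_pow (n m : ℕ) : (quad (X : ℝ[X]) 1 ^ n).coeff m =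
    ∑ k ∈ Finset.range (m + 1), C ((n.choose (m - k) : ℝ) * n.choose k) * X ^ (n - (m - k)) := by
  rw [quad, mul_pow, coeff_mul, Finset.Nat.sum_antidiagonal_eq_sum_range_succ_mk,
    ← Finset.sum_range_reflect]
  refine Finset.sum_congr rfl fun k hk => ?_
  have hk : k ≤ m := Finset.mem_range_succ_iff.1 hk
  rw [coeff_X_add_C_pow, coeff_X_add_C_pow, one_pow, one_mul,
    show m + 1 - 1 - k = m - k by omega, Nat.sub_sub_self hk, C_mul, C_eq_natCast, C_eq_natCast]
  ring

theorem narayanaPolyB_eq_coeff (n : ℕ) : narayanaPolyB n = (quad X 1 ^ n).coeff n := by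
  rw [coeff_quad_X_one_pow, narayanaPolyB]
  refine Finset.sum_congr rfl fun k hk => ?_
  have hk : k ≤ n := Finset.mem_range_succ_iff.1 hk
  rw [Nat.sub_sub_self hk, Nat.choose_symm hk, sq]

theorem succ_mul_narayanaPolyA_succ (n : ℕ) :
    (n + 1) * (1 * narayanaPolyA (n + 1)) = (quad (X : ℝ[X]) 1 ^ (n + 1)).coeff n := by
  rw [coeff_quad_X_one_pow, narayanaPolyA, if_neg n.succ_ne_zero, one_mul, Finset.mul_sum,
    ← Finset.Ico_succ_right_eq_Icc, Finset.sum_Ico_eq_sum_range]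
  refine Finset.sum_congr rfl fun k hk => ?_
  have hk : k ≤ n := Finset.mem_range_succ_iff.1 hk
  have hn : (n : ℝ) + 1 ≠ 0 := n.cast_add_one_ne_zero
  rw [show n + 1 - (n - k) = 1 + k by omega, Nat.add_sub_cancel_left,
    ← Nat.choose_symm_of_eq_add (show n + 1 = (1 + k) + (n - k) by omega),
    show ((n : ℝ[X]) + 1) = C ((n : ℝ) + 1) by simp, ← mul_assoc, ← C_mul]
  push_cast
  field_simp

theorem coeff_quad_one_add_X_pow (n m : ℕ) : (quad (1 + X : ℝ[X]) X ^ n).coeff m =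
    ∑ k ∈ Finset.range (n + 1), C ((n.choose k : ℝ) * (n + k).choose m) * X ^ (n + k - m) := by
  have h : quad (1 + X : ℝ[X]) X ^ n =
      ∑ k ∈ Finset.range (n + 1), C (n.choose k : ℝ[X]) * (X + C X) ^ (n + k) := by
    rw [quad, mul_pow, C_add, C_1, add_left_comm, add_comm 1, add_pow, Finset.sum_mul]
    refine Finset.sum_congr rfl fun k _ => ?_
    rw [C_eq_natCast, one_pow]
    ring
  rw [h, finsetSum_coeff]
  refine Finset.sum_congr rfl fun k _ => ?_
  rw [coeff_C_mul, coeff_X_add_C_pow, C_mul, C_eq_natCast, C_eq_natCast]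
  ring

theorem choose_mul_choose_two_mul {n k : ℕ} (hk : k ≤ n) :
    (n + k).choose (n - k) * (2 * k).choose k = n.choose k * (n + k).choose k := by
  rw [Nat.choose_symm_of_eq_add (show n + k = (n - k) + 2 * k by omega),
    Nat.choose_mul (by omega), Nat.add_sub_cancel, two_mul, Nat.add_sub_cancel, mul_comm]

theorem delannoyPoly_eq_coeff (n : ℕ) : delannoyPoly n = (quad (1 + X) X ^ n).coeff n := by
  rw [coeff_quad_one_add_X_pow, delannoyPoly]
  refine Finset.sum_congr rfl fun k hk => ?_
  have hk : k ≤ n := Finset.mem_range_succ_iff.1 hk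
  rw [Nat.add_sub_cancel_left, ← Nat.cast_mul, choose_mul_choose_two_mul hk,
    Nat.choose_symm_add (a := n) (b := k), Nat.cast_mul]

theorem succ_mul_schroderPoly_succ (n : ℕ) :
    ((n : ℝ[X]) + 1) * (X * schroderPoly (n + 1)) = (quad (1 + X : ℝ[X]) X ^ (n + 1)).coeff n := by
  rw [coeff_quad_one_add_X_pow, schroderPoly, Finset.mul_sum, Finset.mul_sum]
  refine Finset.sum_congr rfl fun k hk => ?_
  have hk : k ≤ n + 1 := Finset.mem_range_succ_iff.1 hk
  have hchoose : ((n + 1 + k).choose (n + 1 - k) : ℝ) * (2 * k).choose k =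
      (n + 1).choose k * (n + 1 + k).choose k := by
    exact_mod_cast choose_mul_choose_two_mul hk
  have habsorb : ((n + 1 + k).choose n : ℝ) * (k + 1) = (n + 1 + k).choose k * (n + 1) := by
    have h := Nat.choose_succ_right_eq (n + 1 + k) k
    rw [Nat.add_sub_cancel,
      Nat.choose_symm_of_eq_add (show n + 1 + k = (k + 1) + n by omega)] at h
    exact_mod_cast h
  have hcoeff : ((n : ℝ) + 1) * ((n + 1 + k).choose (n + 1 - k) * (1 / (k + 1)) *
      (2 * k).choose k) = (n + 1).choose k * (n + 1 + k).choose n := by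
    have hk₀ : (k : ℝ) + 1 ≠ 0 := k.cast_add_one_ne_zero
    field_simp
    linear_combination ((n : ℝ) + 1) * hchoose - ((n + 1).choose k : ℝ) * habsorb
  rw [show n + 1 + k - n = k + 1 by omega, ← hcoeff, C_mul (a := (n : ℝ) + 1),
    C_add, C_1, C_eq_natCast]
  ring

theorem isQLogConvex_narayanaPolyA : IsQLogConvex 3 narayanaPolyA :=
  isQLogConvex_three_of_succ_mul_eq X_mem_nonnegCoeff (one_mem _) one_ne_zero (if_pos rfl)
    succ_mul_narayanaPolyA_succ

theorem isQLogConvex_narayanaPolyB : IsQLogConvex 3 narayanaPolyB :=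
  funext narayanaPolyB_eq_coeff ▸ isQLogConvex_three_coeff_quad_pow X_mem_nonnegCoeff (one_mem _)

theorem isQLogConvex_delannoyPoly : IsQLogConvex 3 delannoyPoly :=
  funext delannoyPoly_eq_coeff ▸
    isQLogConvex_three_coeff_quad_pow (add_mem (one_mem _) X_mem_nonnegCoeff) X_mem_nonnegCoeff

theorem isQLogConvex_schroderPoly : IsQLogConvex 3 schroderPoly :=
  isQLogConvex_three_of_succ_mul_eq (add_mem (one_mem _) X_mem_nonnegCoeff) X_mem_nonnegCoeff
    X_ne_zero (by simp [schroderPoly]) succ_mul_schroderPoly_succ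

end NarayanaDelannoySchroder

section Bell

theorem coeff_bellPoly (n k : ℕ) : (bellPoly n).coeff k = n.stirlingSecond k := by
  simp only [bellPoly, finsetSum_coeff, coeff_C_mul, coeff_X_pow, mul_ite, mul_one, mul_zero,
    Finset.sum_ite_eq, Finset.mem_range]
  split_ifs with h
  · rfl
  · rw [Nat.stirlingSecond_eq_zero_of_lt (by omega), Nat.cast_zero]

theorem bellPoly_succ (n : ℕ) :
    bellPoly (n + 1) = X * (bellPoly n + derivative (bellPoly n)) := by
  ext k
  rcases k with _ | k
  · simp [coeff_bellPoly]
  · rw [coeff_X_mul, coeff_add, coeff_derivative, coeff_bellPoly, coeff_bellPoly, coeff_bellPoly,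
      Nat.stirlingSecond_succ_succ]
    push_cast
    ring

theorem iterate_derivative_succ_X_mul {R : Type*} [CommSemiring R] (p : R[X]) (k : ℕ) :
    derivative^[k + 1] (X * p) =
      X * derivative^[k + 1] p + ((k : R[X]) + 1) * derivative^[k] p := by
  rw [mul_comm, iterate_derivative_mul_X, Nat.add_sub_cancel, nsmul_eq_mul]
  push_cast
  ring

theorem isCatalanStieltjes_iterate_derivative_bellPoly :
    IsCatalanStieltjes (fun n k => derivative^[k] (bellPoly n)) (fun k => (k : ℝ[X]) + 1)
      (fun k => X + (k : ℝ[X])) (fun _ => X) where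
  zero_zero := by simp [bellPoly]
  zero_succ k := by simp [bellPoly]
  succ_zero n := by
    rw [Function.iterate_zero_apply, Function.iterate_zero_apply, Function.iterate_one,
      bellPoly_succ]
    push_cast
    ring
  succ_succ n k := by
    rw [bellPoly_succ, iterate_derivative_succ_X_mul]
    simp only [iterate_map_add, ← Function.iterate_succ_apply]
    push_cast
    ring

theorem isQLogConvex_bellPoly : IsQLogConvex 3 bellPoly :=
  isCatalanStieltjes_iterate_derivative_bellPoly.isQLogConvex_three_of_eq_add (x := fun _ => X)
    (y := fun k => (k : ℝ[X])) (fun k => add_mem (natCast_mem _ k) (one_mem _))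
    (fun _ => X_mem_nonnegCoeff) (fun _ => X_mem_nonnegCoeff) (natCast_mem _) (fun _ => rfl)
    (fun k => by push_cast; ring)

end Bell

section Eulerian

/-- The number of descents of the word `w 0, w 1, …, w n`. -/
def wordDescents (w : ℕ → ℕ) (n : ℕ) : ℕ :=
  Nat.count (fun i => w (i + 1) < w i) n

theorem wordDescents_le (w : ℕ → ℕ) (n : ℕ) : wordDescents w n ≤ n :=
  Nat.count_le _

theorem wordDescents_succ (w : ℕ → ℕ) (n : ℕ) :
    wordDescents w (n + 1) = wordDescents w n + if w (n + 1) < w n then 1 else 0 :=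
  Nat.count_succ _ n

theorem wordDescents_eq_sum (w : ℕ → ℕ) (n : ℕ) :
    wordDescents w n = ∑ i ∈ Finset.range n, if w (i + 1) < w i then 1 else 0 := by
  rw [wordDescents, Nat.count_eq_card_filter_range, Finset.card_filter]

theorem wordDescents_congr {v w : ℕ → ℕ} {n : ℕ} (h : ∀ i ≤ n, v i = w i) :
    wordDescents v n = wordDescents w n := by
  simp only [wordDescents_eq_sum]
  refine Finset.sum_congr rfl fun i hi => ?_
  have hi := Finset.mem_range.1 hi
  rw [h i hi.le, h (i + 1) hi]

/-- The word obtained from `w` by inserting the letter `a` in front of the letter `w j`. -/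
def insertLetter (w : ℕ → ℕ) (j a i : ℕ) : ℕ :=
  if i < j then w i else if i = j then a else w (i - 1)

theorem wordDescents_insertLetter {w : ℕ → ℕ} {a n j : ℕ} (h : ∀ i ≤ n, w i < a) (hj : j ≤ n) :
    wordDescents (insertLetter w j a) (n + 1) =
      wordDescents w n + if 1 ≤ j ∧ w j < w (j - 1) then 0 else 1 := by
  induction n, hj using Nat.le_induction with
  | base =>
    rcases j with _ | j
    · rw [wordDescents_succ, if_pos (by simpa [insertLetter] using h 0 le_rfl)]
      simp [wordDescents]
    · have hcongr : wordDescents (insertLetter w (j + 1) a) j = wordDescents w j :=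
        wordDescents_congr fun i hi => if_pos (Nat.lt_succ_of_le hi)
      have hj₀ : insertLetter w (j + 1) a j = w j := if_pos j.lt_succ_self
      have hj₁ : insertLetter w (j + 1) a (j + 1) = a := by simp [insertLetter]
      have hj₂ : insertLetter w (j + 1) a (j + 2) = w (j + 1) := by simp [insertLetter]
      rw [wordDescents_succ, wordDescents_succ, wordDescents_succ, hcongr, hj₀, hj₁, hj₂,
        if_neg (h j j.le_succ).not_gt, if_pos (h _ le_rfl)]
      simp only [Nat.le_add_left, true_and, Nat.add_sub_cancel]
      split_ifs <;> rfl
  | succ n hj ih =>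
    have hn : insertLetter w j a (n + 1) = w n := by grind [insertLetter]
    have hn' : insertLetter w j a (n + 2) = w (n + 1) := by grind [insertLetter]
    have ih := ih fun i hi => h i (by omega)
    rw [wordDescents_succ, ih, hn, hn', wordDescents_succ]
    ring

/-- The word of a permutation on the letters `1, …, n`, followed by zeros: the first of them
accounts for the `1` by which the descents are shifted in the Eulerian numbers. -/
def permWord {n : ℕ} (σ : Equiv.Perm (Fin n)) (i : ℕ) : ℕ :=
  if h : i < n then σ ⟨i, h⟩ + 1 else 0

theorem permWord_lt {n : ℕ} (σ : Equiv.Perm (Fin n)) (i : ℕ) : permWord σ i < n + 1 := by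
  rw [permWord]
  split_ifs <;> omega

theorem wordDescents_permWord {m : ℕ} (σ : Equiv.Perm (Fin (m + 1))) :
    wordDescents (permWord σ) (m + 1) = descents σ + 1 := by
  rw [wordDescents_succ, if_pos (by simp [permWord]), descents, wordDescents_eq_sum,
    Finset.card_filter, Finset.sum_range]
  congr 1
  refine Finset.sum_congr rfl fun i _ => ?_
  simp only [permWord, Nat.add_lt_add_iff_right, i.2, dite_true, i.2.trans (Nat.lt_succ_self m)]
  rfl

theorem eulerianNumber_eq_card (n k : ℕ) : eulerianNumber n k =
    (Finset.univ.filter fun σ : Equiv.Perm (Fin n) => wordDescents (permWord σ) n = k).card := by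
  rcases n with _ | m
  · simp only [eulerianNumber, wordDescents, Nat.count_zero, Finset.card_filter,
      Finset.univ_unique, Finset.sum_singleton, eq_comm]
  · simp only [eulerianNumber, wordDescents_permWord]

theorem eulerianPoly_eq_sum_perm (n : ℕ) :
    eulerianPoly n = ∑ σ : Equiv.Perm (Fin n), X ^ wordDescents (permWord σ) n := by
  rw [eulerianPoly, ← Finset.sum_fiberwise_of_maps_to (t := Finset.range (n + 1))
    (g := fun σ : Equiv.Perm (Fin n) => wordDescents (permWord σ) n)
    fun σ _ => Finset.mem_range_succ_iff.2 (wordDescents_le _ n)]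
  refine Finset.sum_congr rfl fun k _ => ?_
  rw [Finset.sum_congr rfl fun σ hσ => by rw [(Finset.mem_filter.1 hσ).2], Finset.sum_const,
    ← eulerianNumber_eq_card, nsmul_eq_mul, C_eq_natCast]

section insertMax

variable {n : ℕ} (j : Fin (n + 1)) (σ : Equiv.Perm (Fin n))

/-- The permutation obtained from `σ` by inserting a new largest letter at the place `j`. -/
def insertMax : Equiv.Perm (Fin (n + 1)) :=
  ((finSuccEquiv' j).trans σ.optionCongr).trans (finSuccEquiv' (Fin.last n)).symm

theorem insertMax_self : insertMax j σ j = Fin.last n := by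
  simp [insertMax]

theorem insertMax_succAbove (i : Fin n) : insertMax j σ (j.succAbove i) = (σ i).castSucc := by
  simp [insertMax]

theorem insertMax_bijective (n : ℕ) :
    Function.Bijective fun p : Fin (n + 1) × Equiv.Perm (Fin n) => insertMax p.1 p.2 := by
  refine (Fintype.bijective_iff_injective_and_card _).2 ⟨?_, ?_⟩
  · rintro ⟨j, σ⟩ ⟨k, τ⟩ (h : insertMax j σ = insertMax k τ)
    obtain rfl : j = k := (insertMax j σ).injective (by rw [insertMax_self, h, insertMax_self])
    have hστ : σ = τ := Equiv.ext fun i => Fin.castSucc_injective n (by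
      rw [← insertMax_succAbove j, h, insertMax_succAbove])
    rw [hστ]
  · simp [Fintype.card_perm, Nat.factorial_succ]

theorem permWord_insertMax :
    permWord (insertMax j σ) = insertLetter (permWord σ) j (n + 1) := by
  funext i
  by_cases hi : i < n + 1
  · lift i to Fin (n + 1) using hi
    rw [permWord, dif_pos i.2]
    rcases Fin.eq_self_or_eq_succAbove j i with rfl | ⟨i, rfl⟩
    · simp [insertLetter, insertMax_self]
    · rw [Fin.eta, insertMax_succAbove]
      rcases lt_or_ge i.castSucc j with h | h
      · rw [Fin.succAbove_of_castSucc_lt _ _ h, Fin.val_castSucc, Fin.val_castSucc, insertLetter,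
          if_pos (show (i : ℕ) < j from h), permWord, dif_pos i.2]
      · have h' : (j : ℕ) < i + 1 := Nat.lt_succ_of_le (Fin.le_def.1 h)
        rw [Fin.succAbove_of_le_castSucc _ _ h, Fin.val_castSucc, Fin.val_succ, insertLetter,
          if_neg h'.not_gt, if_neg h'.ne', Nat.add_sub_cancel, permWord, dif_pos i.2]
  · grind [insertLetter, permWord]

/-- Inserting the new largest letter in front of the second letter of a descent (`0` included)
preserves the number of descents, and everywhere else it creates one. -/
theorem sum_wordDescents_insertMax {R : Type*} [CommRing R] (F : ℕ → R) :
    ∑ j, F (wordDescents (permWord (insertMax j σ)) (n + 1)) =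
      wordDescents (permWord σ) n * F (wordDescents (permWord σ) n) +
        (n + 1 - wordDescents (permWord σ) n) * F (wordDescents (permWord σ) n + 1) := by
  set w := permWord σ
  set d := wordDescents w n with hd
  have hcard : ((Finset.range (n + 1)).filter fun j => 1 ≤ j ∧ w j < w (j - 1)).card = d := by
    rw [hd, wordDescents_eq_sum, Finset.card_filter, Finset.sum_range_succ']
    simp
  have hterm (j : Fin (n + 1)) : F (wordDescents (permWord (insertMax j σ)) (n + 1)) =
      F (d + 1) + if 1 ≤ (j : ℕ) ∧ w j < w (j - 1) then F d - F (d + 1) else 0 := by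
    rw [permWord_insertMax,
      wordDescents_insertLetter (fun i _ => permWord_lt σ i) (Nat.le_of_lt_succ j.2)]
    split_ifs
    · exact (add_sub_cancel _ _).symm
    · exact (add_zero _).symm
  rw [Finset.sum_congr rfl fun j _ => hterm j, Finset.sum_add_distrib,
    Fin.sum_univ_eq_sum_range fun j => if 1 ≤ j ∧ w j < w (j - 1) then F d - F (d + 1) else 0,
    ← Finset.sum_filter, Finset.sum_const, Finset.sum_const, hcard, Finset.card_fin,
    nsmul_eq_mul, nsmul_eq_mul]
  push_cast
  ring

end insertMax

/-- The homogenization of the Eulerian polynomial, evaluated at `X + q` and `X + 1`, where `q` is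
the variable of the Eulerian polynomial. -/
noncomputable def eulerianShift (n : ℕ) : ℝ[X][X] :=
  ∑ σ : Equiv.Perm (Fin n),
    (X + C X) ^ wordDescents (permWord σ) n * (X + 1) ^ (n - wordDescents (permWord σ) n)

theorem eulerianPoly_eq_coeff_eulerianShift (n : ℕ) :
    eulerianPoly n = (eulerianShift n).coeff 0 := by
  simp [eulerianPoly_eq_sum_perm, eulerianShift, coeff_zero_eq_eval_zero, eval_finsetSum]

theorem eulerianShift_succ (n : ℕ) :
    eulerianShift (n + 1) = (X + C X) * derivative ((X + 1) * eulerianShift n) := by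
  rw [eulerianShift, ← (insertMax_bijective n).sum_comp, Fintype.sum_prod_type_right,
    eulerianShift, Finset.mul_sum, derivative_sum, Finset.mul_sum]
  refine Finset.sum_congr rfl fun σ _ => ?_
  rw [sum_wordDescents_insertMax σ
    fun d => (X + C X : ℝ[X][X]) ^ d * (X + 1) ^ (n + 1 - d)]
  obtain ⟨e, he⟩ := Nat.exists_eq_add_of_le (wordDescents_le (permWord σ) n)
  generalize wordDescents (permWord σ) n = d at he ⊢
  subst he
  rw [show d + e + 1 - d = e + 1 by omega, show d + e + 1 - (d + 1) = e by omega,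
    Nat.add_sub_cancel_left, mul_left_comm (X + 1 : ℝ[X][X]), ← pow_succ', derivative_mul]
  have hd : (X + C X) * derivative ((X + C X) ^ d) = (d : ℝ[X][X]) * (X + C X) ^ d := by
    rcases d with _ | d
    · rw [pow_zero, derivative_one, mul_zero, Nat.cast_zero, zero_mul]
    · rw [derivative_X_add_C_pow, Nat.add_sub_cancel, pow_succ', mul_left_comm, C_eq_natCast]
  have he' : derivative ((X + 1) ^ (e + 1)) = ((e : ℝ[X][X]) + 1) * (X + 1) ^ e := by
    rw [derivative_pow_succ, derivative_add, derivative_X, derivative_one, add_zero, mul_one,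
      C_add, C_1, C_eq_natCast]
  rw [he']
  push_cast
  linear_combination -(X + 1) ^ (e + 1) * hd

theorem isCatalanStieltjes_coeff_eulerianShift :
    IsCatalanStieltjes (fun n k => (eulerianShift n).coeff k) (fun k => (k : ℝ[X]) + 1)
      (fun k => ((k : ℝ[X]) + 1) * X + (k : ℝ[X])) (fun k => ((k : ℝ[X]) + 1) * X) where
  zero_zero := by simp [eulerianShift, wordDescents]
  zero_succ k := by simp [eulerianShift, wordDescents, coeff_one]
  succ_zero n := by
    rw [eulerianShift_succ]
    simp only [add_mul, one_mul, derivative_add, coeff_add, coeff_C_mul, coeff_X_mul_zero,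
      coeff_derivative, coeff_X_mul]
    push_cast
    ring
  succ_succ n k := by
    rw [eulerianShift_succ]
    simp only [add_mul, one_mul, derivative_add, coeff_add, coeff_C_mul, coeff_derivative,
      coeff_X_mul]
    push_cast
    ring

theorem isQLogConvex_eulerianPoly : IsQLogConvex 3 eulerianPoly := by
  have hu (k : ℕ) : (k + 1 : ℝ[X]) ∈ nonnegCoeff := add_mem (natCast_mem _ k) (one_mem _)
  have hs (k : ℕ) : (k + 1 : ℝ[X]) * X ∈ nonnegCoeff := mul_mem (hu k) X_mem_nonnegCoeff
  rw [funext eulerianPoly_eq_coeff_eulerianShift]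
  exact isCatalanStieltjes_coeff_eulerianShift.isQLogConvex_three_of_eq_add
    (y := fun k => (k : ℝ[X])) hu hs hs (natCast_mem _) (fun _ => rfl) (fun k => by push_cast; ring)

end Eulerian

end QLogConvex

theorem proposition4p3 :
    QLogConvex.IsQLogConvex 3 QLogConvex.bellPoly ∧
    QLogConvex.IsQLogConvex 3 QLogConvex.eulerianPoly ∧
    QLogConvex.IsQLogConvex 3 QLogConvex.schroderPoly ∧
    QLogConvex.IsQLogConvex 3 QLogConvex.delannoyPoly ∧
    QLogConvex.IsQLogConvex 3 QLogConvex.narayanaPolyA ∧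
    QLogConvex.IsQLogConvex 3 QLogConvex.narayanaPolyB :=
  ⟨QLogConvex.isQLogConvex_bellPoly, QLogConvex.isQLogConvex_eulerianPoly,
    QLogConvex.isQLogConvex_schroderPoly, QLogConvex.isQLogConvex_delannoyPoly,
    QLogConvex.isQLogConvex_narayanaPolyA, QLogConvex.isQLogConvex_narayanaPolyB⟩
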